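/- Let $d\ge 0$, let $\Omega\subset\mathbb R^d$ be a bounded convex open set, and let $\lambda$ denote Lebesgue measure. Let $I$ be a countable (finite or infinite) index set, let $v_i\in\mathbb R^d$ $(i\in I)$ be pairwise distinct vectors, and let $m_i>0$ $(i\in I)$ be real numbers with $\sum_{i\in I} m_i=\lambda(\Omega)$. Call a function $\varphi:\Omega\to\mathbb R$ *locally affine a.e.* if for almost every $x\in\Omega$ it is affine on some neighborhood of $x$. Then there is a convex function $\varphi:\Omega\to\mathbb R$ that is locally affine a.e., together with open convex sets $A_i\subset\Omega$ $(i\in I)$, such that for every $i\in I$ $$\lambda(A_i)=m_i\qquad\text{and}\qquad \nabla\varphi=v_i\ \text{ on } A_i ,$$ and the $A_i$ are exactly the connected components of the set $\{x\in\Omega:\varphi\text{ is affine on a neighborhood of }x\}$. Moreover $\varphi$ is unique up to an additive constant: if $\psi:\Omega\to\mathbb R$ is convex and locally affine a.e., and for every $i\in I$ one has $\nabla\psi=v_i$ on some open convex set $B_i\subset\Omega$ with $\lambda(B_i)=m_i$, then $\psi-\varphi$ is constant on $\Omega$. -/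

import Mathlib

open MeasureTheory Topology

/-- The function `φ` is affine on some neighborhood of `x`. -/
def AffineNear {d : ℕ} (φ : EuclideanSpace ℝ (Fin d) → ℝ) (x : EuclideanSpace ℝ (Fin d)) : Prop :=
  ∃ g : EuclideanSpace ℝ (Fin d) →ᵃ[ℝ] ℝ, ∀ᶠ y in 𝓝 x, φ y = g y

/-- The set of points `x ∈ Ω` such that `φ` is affine on a neighborhood of `x`. For open `Ω` it
depends only on the values of `φ` on `Ω`. -/
def affineSet {d : ℕ} (Ω : Set (EuclideanSpace ℝ (Fin d))) (φ : EuclideanSpace ℝ (Fin d) → ℝ) :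
    Set (EuclideanSpace ℝ (Fin d)) :=
  {x | x ∈ Ω ∧ AffineNear φ x}

/-- `φ` is locally affine a.e. on `Ω`: for Lebesgue-a.e. `x ∈ Ω`, the function `φ` is affine on
some neighborhood of `x`. -/
def LocallyAffineAE {d : ℕ} (Ω : Set (EuclideanSpace ℝ (Fin d)))
    (φ : EuclideanSpace ℝ (Fin d) → ℝ) : Prop :=
  ∀ᵐ x ∂(volume : Measure (EuclideanSpace ℝ (Fin d))), x ∈ Ω → AffineNear φ x

/-- The sets `A i` are open convex subsets of `Ω` of Lebesgue measure `m i`, and `∇φ = v i` on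
`A i` (in particular `φ` is differentiable there). -/
structure HasPieces {d : ℕ} {ι : Type*} (Ω : Set (EuclideanSpace ℝ (Fin d)))
    (v : ι → EuclideanSpace ℝ (Fin d)) (m : ι → ℝ) (φ : EuclideanSpace ℝ (Fin d) → ℝ)
    (A : ι → Set (EuclideanSpace ℝ (Fin d))) : Prop where
  subset : ∀ i, A i ⊆ Ω
  isOpen : ∀ i, IsOpen (A i)
  convex : ∀ i, Convex ℝ (A i)
  measure_eq : ∀ i, volume (A i) = ENNReal.ofReal (m i)
  gradient_eq : ∀ i, ∀ x ∈ A i, HasGradientAt φ (v i) x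

/-! The function is sought as `φ x = ⨆ i, (⟪v i, x⟫ - a i)`, and its affine pieces are the Laguerre
cells of the offsets `a`: this is semi-discrete optimal transport. Existence: for finitely many
vectors, a minimizer of the convex dual functional gives every cell measure at least `m i`. Its
offsets lie in a box that does not depend on the masses, so compactness carries this to countable
families (`exists_le_measure_laguerreCell`). Since the masses add up to the measure of `Ω`, the
bounds are equalities and the cells cover `Ω` up to a null set. Uniqueness: let `a`, `b` be the
offsets of `φ`, `ψ`. Comparing masses over the indices with large `a l - b l`
(`HasPieces.offset_le`) shows that `ψ - φ` takes almost all its values in the countable set of the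
`a i - b i`. A locally Lipschitz function with this property on a connected open set is constant. -/

open Set Filter Bornology
open scoped ENNReal RealInnerProductSpace

/-! ### Finite families: minimizing the dual functional. -/

section LaguerreCells

variable {E : Type*} [NormedAddCommGroup E] [InnerProductSpace ℝ E]

/-- The part of `Ω` on which the affine function `⟪v i, ·⟫ - a i` dominates all the others. -/
def laguerreCell {ι : Type*} (Ω : Set E) (v : ι → E) (a : ι → ℝ) (i : ι) : Set E :=
  {x | x ∈ Ω ∧ ∀ j, ⟪v j, x⟫ - a j ≤ ⟪v i, x⟫ - a i}

/-- The maximum of finitely many affine functions `⟪v i, ·⟫ - a i`. -/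
noncomputable def maxAffine {κ : Type*} [Fintype κ] [Nonempty κ] (v : κ → E) (a : κ → ℝ) (x : E) :
    ℝ :=
  Finset.univ.sup' Finset.univ_nonempty fun i => ⟪v i, x⟫ - a i

section Fintype

variable {κ : Type*} [Fintype κ] [Nonempty κ] {v : κ → E}

lemma le_maxAffine (a : κ → ℝ) (x : E) (i : κ) : ⟪v i, x⟫ - a i ≤ maxAffine v a x :=
  Finset.le_sup' (fun i => ⟪v i, x⟫ - a i) (Finset.mem_univ i)

lemma maxAffine_le {a : κ → ℝ} {x : E} {c : ℝ} (h : ∀ i, ⟪v i, x⟫ - a i ≤ c) :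
    maxAffine v a x ≤ c :=
  Finset.sup'_le _ _ fun i _ => h i

lemma continuous_maxAffine (v : κ → E) :
    Continuous fun p : (κ → ℝ) × E => maxAffine v p.1 p.2 := by
  unfold maxAffine
  refine Continuous.finset_sup'_apply _ fun i _ => ?_
  fun_prop

lemma continuous_maxAffine_right (v : κ → E) (a : κ → ℝ) : Continuous (maxAffine v a) :=
  (continuous_maxAffine v).comp (Continuous.prodMk_right a)

variable [FiniteDimensional ℝ E] [MeasurableSpace E] [BorelSpace E]
  {μ : Measure E} [IsFiniteMeasureOnCompacts μ] {Ω : Set E}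

lemma integrableOn_maxAffine (hΩ : IsBounded Ω) (v : κ → E) (a : κ → ℝ) :
    IntegrableOn (maxAffine v a) Ω μ := by
  have : IsCompact (closure Ω) := hΩ.isCompact_closure
  exact ((continuous_maxAffine_right v a).continuousOn.integrableOn_compact this).mono_set
    subset_closure

/-- The dual (Kantorovich) functional of semi-discrete optimal transport. -/
noncomputable def dualFunctional (μ : Measure E) (Ω : Set E) (v : κ → E) (m a : κ → ℝ) : ℝ :=
  (∫ x in Ω, maxAffine v a x ∂μ) + ∑ i, m i * a i

lemma continuous_dualFunctional (hΩ : IsBounded Ω) (m : κ → ℝ) :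
    Continuous (dualFunctional μ Ω v m) := by
  unfold dualFunctional
  refine Continuous.add ?_ (by fun_prop)
  have h := continuous_parametric_integral_of_continuous (μ := μ.restrict Ω)
    (f := maxAffine v) (continuous_maxAffine v) hΩ.isCompact_closure
  simpa [Measure.restrict_restrict_of_subset, isClosed_closure.measurableSet,
    Measure.restrict_restrict, inter_eq_self_of_subset_right subset_closure] using h

/-- Every point can be replaced by one in a fixed box without increasing the dual functional. -/
lemma exists_mem_Icc_dualFunctional_le (hΩ : IsBounded Ω) {R : ℝ}
    (hR : ∀ x ∈ Ω, ‖x‖ ≤ R) (hR0 : 0 ≤ R) (hΩm : MeasurableSet Ω) {m : κ → ℝ} (hm : ∀ i, 0 ≤ m i)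
    (hsum : ∑ i, m i = (μ Ω).toReal) (k : κ) (b : κ → ℝ) :
    ∃ a ∈ Icc (fun i => -(R * ‖v i - v k‖)) (fun i => R * ‖v i - v k‖),
      dualFunctional μ Ω v m a ≤ dualFunctional μ Ω v m b := by
  set C : κ → ℝ := fun i => R * ‖v i - v k‖ with hC
  have hC0 : ∀ i, 0 ≤ C i := fun i => by positivity
  -- Capping `b i` at `s + C i` leaves the maximum unchanged on `Ω`, because there the `j`-th
  -- function dominates each capped one. It can only lower the sum. The shift by `s` is neutral
  -- since `∑ i, m i` is the measure of `Ω`.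
  set s : ℝ := Finset.univ.inf' Finset.univ_nonempty fun j => b j + C j
  have hs : ∀ j, s ≤ b j + C j := fun j => Finset.inf'_le _ (Finset.mem_univ j)
  obtain ⟨j, -, hj⟩ := Finset.exists_mem_eq_inf' (s := (Finset.univ : Finset κ))
    Finset.univ_nonempty fun j => b j + C j
  have hj : s = b j + C j := hj
  refine ⟨fun i => min (b i) (s + C i) - s, ⟨fun i => ?_, fun i => ?_⟩, ?_⟩
  · show -C i ≤ min (b i) (s + C i) - s
    have := hs i
    have := hC0 i
    have : s - C i ≤ min (b i) (s + C i) := le_min (by linarith) (by linarith)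
    linarith
  · show min (b i) (s + C i) - s ≤ C i
    have := min_le_right (b i) (s + C i)
    linarith
  · have hin : ∀ x ∈ Ω, ∀ i, |⟪v i, x⟫ - ⟪v k, x⟫| ≤ C i := fun x hx i => by
      rw [← inner_sub_left]
      refine (abs_real_inner_le_norm _ _).trans ?_
      rw [mul_comm]
      exact mul_le_mul_of_nonneg_right (hR x hx) (norm_nonneg _)
    have hmax : ∀ x ∈ Ω, maxAffine v (fun i => min (b i) (s + C i) - s) x ≤ maxAffine v b x + s := by
      intro x hx
      refine maxAffine_le fun i => ?_
      rcases min_choice (b i) (s + C i) with h | h <;> rw [h]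
      · linarith [le_maxAffine (v := v) b x i]
      · linarith [le_maxAffine (v := v) b x j, (abs_le.1 (hin x hx i)).2,
          (abs_le.1 (hin x hx j)).1]
    have hfin : μ Ω ≠ ∞ := hΩ.measure_lt_top.ne
    have hint : ∫ x in Ω, maxAffine v (fun i => min (b i) (s + C i) - s) x ∂μ
        ≤ (∫ x in Ω, maxAffine v b x ∂μ) + s * (μ Ω).toReal := by
      have h1 : IntegrableOn (fun _ : E => s) Ω μ := integrableOn_const hfin
      calc _ ≤ ∫ x in Ω, (maxAffine v b x + s) ∂μ :=
            setIntegral_mono_on (integrableOn_maxAffine hΩ _ _)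
              ((integrableOn_maxAffine hΩ _ _).add h1) hΩm hmax
        _ = _ := by
            rw [integral_add (integrableOn_maxAffine hΩ _ _) h1]
            simp [Measure.real, mul_comm]
    have hs2 : ∑ i, m i * (min (b i) (s + C i) - s) ≤ ∑ i, m i * b i - s * (μ Ω).toReal := by
      rw [← hsum, Finset.mul_sum, ← Finset.sum_sub_distrib]
      refine Finset.sum_le_sum fun i _ => ?_
      have := mul_le_mul_of_nonneg_left (min_le_left (b i) (s + C i)) (hm i)
      linarith
    unfold dualFunctional
    linarith

/-- At a minimum of the dual functional, all cells have at least the prescribed measure. -/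
lemma le_measure_laguerreCell_of_isMin (hΩ : IsBounded Ω) (hΩm : MeasurableSet Ω)
    {m a : κ → ℝ}
    (ha : ∀ b, dualFunctional μ Ω v m a ≤ dualFunctional μ Ω v m b) (i : κ) :
    ENNReal.ofReal (m i) ≤ μ (laguerreCell Ω v a i) := by
  classical
  have hfin : μ Ω ≠ ∞ := hΩ.measure_lt_top.ne
  have hclosed : ∀ t : ℝ, MeasurableSet {x | maxAffine v a x ≤ ⟪v i, x⟫ - a i + t} := fun t =>
    (isClosed_le (continuous_maxAffine_right v a) (by fun_prop)).measurableSet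
  set S : ℝ → Set E := fun t => Ω ∩ {x | maxAffine v a x ≤ ⟪v i, x⟫ - a i + t} with hS
  have hSm : ∀ t, MeasurableSet (S t) := fun t => hΩm.inter (hclosed t)
  have key : ∀ t : ℝ, 0 < t → ENNReal.ofReal (m i) ≤ μ (S t) := by
    intro t ht
    have hSfin : μ (S t) ≠ ∞ := measure_ne_top_of_subset inter_subset_left hfin
    -- Lowering one offset by `t` raises the maximum by at most `t`, and only on `S t`. Minimality
    -- then gives `t * m i ≤ t * μ (S t)`, and the cell is the limit of `S t` as `t → 0`.
    set b : κ → ℝ := a - Pi.single i t with hb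
    have hpt : ∀ x ∈ Ω, maxAffine v b x
        ≤ maxAffine v a x + (S t).indicator (fun _ => t) x := by
      intro x hx
      have h0 : 0 ≤ (S t).indicator (fun _ => t) x := indicator_nonneg (fun _ _ => ht.le) x
      refine maxAffine_le fun j => ?_
      by_cases hji : j = i
      · subst hji
        by_cases hxS : x ∈ S t
        · rw [indicator_of_mem hxS]
          have := le_maxAffine (v := v) a x j
          simp [hb]; linarith
        · have : ¬ maxAffine v a x ≤ ⟪v j, x⟫ - a j + t := fun h => hxS ⟨hx, h⟩
          simp [hb]; linarith
      · have := le_maxAffine (v := v) a x j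
        simp [hb, hji]; linarith
    have hind : IntegrableOn ((S t).indicator fun _ => t) Ω μ :=
      (integrable_indicator_iff (hSm t)).2
        (integrableOn_const (measure_ne_top_of_subset inter_subset_left hfin)).restrict
    have hint : ∫ x in Ω, maxAffine v b x ∂μ
        ≤ (∫ x in Ω, maxAffine v a x ∂μ) + t * (μ (S t)).toReal := by
      calc _ ≤ ∫ x in Ω, (maxAffine v a x + (S t).indicator (fun _ => t) x) ∂μ :=
            setIntegral_mono_on (integrableOn_maxAffine hΩ _ _)
              ((integrableOn_maxAffine hΩ _ _).add hind) hΩm hpt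
        _ = _ := by
            rw [integral_add (integrableOn_maxAffine hΩ _ _) hind, integral_indicator (hSm t),
              Measure.restrict_restrict (hSm t),
              inter_eq_self_of_subset_left (inter_subset_left : S t ⊆ Ω), setIntegral_const,
              smul_eq_mul, mul_comm, Measure.real]
    have hs : ∑ j, m j * b j = ∑ j, m j * a j - m i * t := by
      simp [hb, mul_sub, Finset.sum_sub_distrib, Pi.single_apply]
    have h := ha b
    unfold dualFunctional at h
    have : t * m i ≤ t * (μ (S t)).toReal := by linarith
    exact (ENNReal.ofReal_le_iff_le_toReal hSfin).2 (le_of_mul_le_mul_left this ht)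
  have hanti : Antitone fun n : ℕ => S (1 / ((n : ℝ) + 1)) := by
    intro n k hnk x hx
    have h1 : maxAffine v a x ≤ ⟪v i, x⟫ - a i + 1 / ((k : ℝ) + 1) := hx.2
    have h2 := Nat.one_div_le_one_div (α := ℝ) hnk
    exact ⟨hx.1, h1.trans (by linarith)⟩
  have hlim := tendsto_measure_iInter_atTop (μ := μ)
    (fun n : ℕ => (hSm (1 / ((n : ℝ) + 1))).nullMeasurableSet) hanti
    ⟨0, measure_ne_top_of_subset inter_subset_left hfin⟩
  refine (ge_of_tendsto' hlim fun n => key _ (by positivity)).trans (measure_mono ?_)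
  intro x hx
  rw [mem_iInter] at hx
  refine ⟨(hx 0).1, fun j => (le_maxAffine a x j).trans ?_⟩
  refine ge_of_tendsto' (f := fun n : ℕ => ⟪v i, x⟫ - a i + 1 / ((n : ℝ) + 1)) (x := atTop) ?_
    fun n => (hx n).2
  simpa using tendsto_one_div_add_atTop_nhds_zero_nat.const_add (⟪v i, x⟫ - a i)

/-- The box depends only on `R` and the distances `‖v i - v k‖`; this uniformity is what permits the
passage to infinite families. -/
theorem exists_le_measure_laguerreCell_of_fintype (hΩ : IsBounded Ω) (hΩm : MeasurableSet Ω)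
    {R : ℝ} (hR : ∀ x ∈ Ω, ‖x‖ ≤ R) (hR0 : 0 ≤ R) {m : κ → ℝ} (hm : ∀ i, 0 ≤ m i)
    (hsum : ∑ i, m i = (μ Ω).toReal) (k : κ) :
    ∃ a ∈ Icc (fun i => -(R * ‖v i - v k‖)) (fun i => R * ‖v i - v k‖),
      ∀ i, ENNReal.ofReal (m i) ≤ μ (laguerreCell Ω v a i) := by
  obtain ⟨a, haK, ha⟩ := (isCompact_Icc (a := fun i => -(R * ‖v i - v k‖))
    (b := fun i => R * ‖v i - v k‖)).exists_isMinOn (nonempty_Icc.2 fun i => by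
      have : 0 ≤ R * ‖v i - v k‖ := by positivity
      linarith) (continuous_dualFunctional (μ := μ) (v := v) hΩ m).continuousOn
  refine ⟨a, haK, le_measure_laguerreCell_of_isMin hΩ hΩm fun b => ?_⟩
  obtain ⟨c, hc, hcb⟩ := exists_mem_Icc_dualFunctional_le (v := v) hΩ hR hR0 hΩm hm hsum k b
  exact (ha hc).trans hcb

end Fintype

end LaguerreCells

/-! ### Countable families: compactness of the offsets. -/

section LaguerreCellsCountable

variable {E : Type*} [NormedAddCommGroup E] [InnerProductSpace ℝ E]
  {ι : Type*} {Ω : Set E} {v : ι → E} {a : ι → ℝ}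

lemma laguerreCell_eq_inter (Ω : Set E) (v : ι → E) (a : ι → ℝ) (i : ι) :
    laguerreCell Ω v a i = Ω ∩ ⋂ j, {x | ⟪v j, x⟫ - a j ≤ ⟪v i, x⟫ - a i} := by
  ext x; simp [laguerreCell]

lemma convex_laguerreCell (hΩ : Convex ℝ Ω) (i : ι) : Convex ℝ (laguerreCell Ω v a i) := by
  rw [laguerreCell_eq_inter]
  refine hΩ.inter (convex_iInter fun j x hx y hy s t hs ht hst => ?_)
  simp only [mem_ofPred_eq, inner_add_right, inner_smul_right] at hx hy ⊢
  obtain rfl : s = 1 - t := by linarith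
  nlinarith [mul_le_mul_of_nonneg_left hx hs, mul_le_mul_of_nonneg_left hy ht]

lemma convexOn_iSup_affine (hΩ : Convex ℝ Ω) [Nonempty ι]
    (hb : ∀ x ∈ Ω, BddAbove (range fun i => ⟪v i, x⟫ - a i)) :
    ConvexOn ℝ Ω fun x => ⨆ i, (⟪v i, x⟫ - a i) := by
  refine ⟨hΩ, fun x hx y hy s t hs ht hst => ciSup_le fun i => ?_⟩
  have h1 := mul_le_mul_of_nonneg_left (le_ciSup (hb x hx) i) hs
  have h2 := mul_le_mul_of_nonneg_left (le_ciSup (hb y hy) i) ht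
  simp only [smul_eq_mul, inner_add_right, inner_smul_right]
  obtain rfl : s = 1 - t := by linarith
  linarith

variable [MeasurableSpace E] [BorelSpace E]

lemma measurableSet_laguerreCell (hΩ : MeasurableSet Ω) (i : ι) :
    MeasurableSet (laguerreCell Ω v a i) := by
  rw [laguerreCell_eq_inter]
  exact hΩ.inter (isClosed_iInter fun j =>
    isClosed_le (by fun_prop) (by fun_prop)).measurableSet

variable [FiniteDimensional ℝ E] {μ : Measure E}

lemma exists_le_measure_laguerreCell_of_finset [IsFiniteMeasureOnCompacts μ]
    (hΩ : IsBounded Ω) (hΩm : MeasurableSet Ω)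
    {R : ℝ} (hR : ∀ x ∈ Ω, ‖x‖ ≤ R) (hR0 : 0 ≤ R) {m : ι → ℝ} (hm : ∀ i, 0 ≤ m i)
    (hsum : HasSum m (μ Ω).toReal) (k : ι) {s : Finset ι} (hk : k ∈ s) :
    ∃ a ∈ Icc (fun i => -(R * ‖v i - v k‖)) (fun i => R * ‖v i - v k‖),
      ∀ i ∈ s, ENNReal.ofReal (m i)
        ≤ μ {x | x ∈ Ω ∧ ∀ j ∈ s, ⟪v j, x⟫ - a j ≤ ⟪v i, x⟫ - a i} := by
  classical
  have : Nonempty s := ⟨⟨k, hk⟩⟩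
  -- The mass of the omitted indices is given to `k`, so that the totals balance.
  set r : ℝ := (μ Ω).toReal - ∑ i ∈ s, m i
  have hr : 0 ≤ r := sub_nonneg.2 (sum_le_hasSum s (fun i _ => hm i) hsum)
  let k' : s := ⟨k, hk⟩
  set m' : s → ℝ := fun i => m i + Pi.single (M := fun _ => ℝ) k' r i
  have hmm : ∀ i : s, m i ≤ m' i := fun i => by
    have : (0 : s → ℝ) ≤ Pi.single (M := fun _ => ℝ) k' r := Pi.single_nonneg.2 hr
    have := this i
    simpa [m'] using this
  have hsum' : ∑ i, m' i = (μ Ω).toReal := by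
    simp only [m', Finset.sum_add_distrib, Finset.sum_pi_single',
      Finset.sum_coe_sort s m]
    simp [r]
  obtain ⟨a, haK, ha⟩ := exists_le_measure_laguerreCell_of_fintype (v := fun i : s => v i) hΩ hΩm
    hR hR0 (fun i => (hm i).trans (hmm i)) hsum' ⟨k, hk⟩
  refine ⟨fun i => if h : i ∈ s then a ⟨i, h⟩ else 0, ⟨fun i => ?_, fun i => ?_⟩, fun i hi => ?_⟩
  · have : 0 ≤ R * ‖v i - v k‖ := by positivity
    by_cases h : i ∈ s
    · simpa [h] using haK.1 ⟨i, h⟩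
    · simpa [h] using this
  · have : 0 ≤ R * ‖v i - v k‖ := by positivity
    by_cases h : i ∈ s
    · simpa [h] using haK.2 ⟨i, h⟩
    · simpa [h] using this
  · refine ((ENNReal.ofReal_le_ofReal (hmm ⟨i, hi⟩)).trans (ha ⟨i, hi⟩)).trans (measure_mono ?_)
    rintro x ⟨hx, h⟩
    refine ⟨hx, fun j hj => ?_⟩
    simpa [hi, hj] using h ⟨j, hj⟩

theorem exists_le_measure_laguerreCell [IsFiniteMeasureOnCompacts μ] [Countable ι] [Nonempty ι]
    (hΩ : IsBounded Ω) (hΩm : MeasurableSet Ω) (v : ι → E) {m : ι → ℝ} (hm : ∀ i, 0 ≤ m i)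
    (hsum : HasSum m (μ Ω).toReal) :
    ∃ a : ι → ℝ, ∀ i, ENNReal.ofReal (m i) ≤ μ (laguerreCell Ω v a i) := by
  classical
  obtain ⟨k⟩ := ‹Nonempty ι›
  have : Nonempty ι := ⟨k⟩
  obtain ⟨R, hR0, hR⟩ := hΩ.exists_pos_norm_le
  obtain ⟨e, he⟩ := exists_surjective_nat ι
  set s : ℕ → Finset ι := fun n => insert k ((Finset.range n).image e)
  have hs : ∀ i, ∀ᶠ n in atTop, i ∈ s n := fun i => by
    obtain ⟨p, rfl⟩ := he i
    filter_upwards [eventually_gt_atTop p] with n hn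
    exact Finset.mem_insert_of_mem (Finset.mem_image_of_mem e (Finset.mem_range.2 hn))
  choose b hbK hb using fun n => exists_le_measure_laguerreCell_of_finset (v := v) hΩ hΩm hR
    hR0.le hm hsum k (Finset.mem_insert_self k ((Finset.range n).image e))
  obtain ⟨a, -, u, hu, hlim⟩ := isCompact_Icc.tendsto_subseq hbK
  have hlim : ∀ i, Tendsto (fun n => b (u n) i) atTop (𝓝 (a i)) := tendsto_pi_nhds.1 hlim
  refine ⟨a, fun i => ?_⟩
  set T : ℕ → Set E := fun n =>
    {x | x ∈ Ω ∧ ∀ j ∈ s (u n), ⟪v j, x⟫ - b (u n) j ≤ ⟪v i, x⟫ - b (u n) i} with hT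
  have hTm : ∀ n, MeasurableSet (T n) := fun n => by
    have : T n = Ω ∩ ⋂ j ∈ s (u n), {x | ⟪v j, x⟫ - b (u n) j ≤ ⟪v i, x⟫ - b (u n) i} := by
      ext x; simp [hT]
    rw [this]
    exact hΩm.inter (isClosed_biInter fun j _ =>
      isClosed_le (by fun_prop) (by fun_prop)).measurableSet
  have hTΩ : ∀ n, T n ⊆ Ω := fun n x hx => hx.1
  -- The intersection of the `U N` is the limsup of the truncated cells. It keeps measure at least
  -- `m i` because `Ω` has finite measure, and it lies in the limit cell because the inequalities
  -- are closed.
  set U : ℕ → Set E := fun N => ⋃ n ≥ N, T n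
  have hUΩ : ∀ N, U N ⊆ Ω := fun N => iUnion₂_subset fun n _ => hTΩ n
  have hUm : ∀ N, MeasurableSet (U N) := fun N =>
    MeasurableSet.iUnion fun n => MeasurableSet.iUnion fun _ => hTm n
  have hanti : Antitone U := fun N M hNM =>
    biUnion_mono (fun n hn => le_trans hNM hn) fun _ _ => le_rfl
  have hU : ∀ N, ENNReal.ofReal (m i) ≤ μ (U N) := fun N => by
    obtain ⟨n, hnN, hn⟩ := ((eventually_ge_atTop N).and
      (hu.tendsto_atTop.eventually (hs i))).exists
    exact (hb (u n) i hn).trans (measure_mono (subset_biUnion_of_mem (u := T) hnN))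
  refine (ge_of_tendsto' (tendsto_measure_iInter_atTop (μ := μ)
    (fun N => (hUm N).nullMeasurableSet) hanti
    ⟨0, measure_ne_top_of_subset (hUΩ 0) hΩ.measure_lt_top.ne⟩) hU).trans (measure_mono ?_)
  intro x hx
  rw [mem_iInter] at hx
  refine ⟨hUΩ 0 (hx 0), fun j => ?_⟩
  have hfreq : ∃ᶠ n in atTop, x ∈ T n := by
    rw [frequently_atTop]
    intro N
    obtain ⟨n, hn, h⟩ := mem_iUnion₂.1 (hx N)
    exact ⟨n, hn, h⟩
  have hfreq2 : ∃ᶠ n in atTop, ⟪v j, x⟫ - b (u n) j ≤ ⟪v i, x⟫ - b (u n) i :=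
    (hfreq.and_eventually (hu.tendsto_atTop.eventually (hs j))).mono fun n hn => hn.1.2 j hn.2
  by_contra hlt
  exact hfreq2 ((((hlim i).const_sub _).eventually_lt ((hlim j).const_sub _)
    (not_le.1 hlt)).mono fun n hn => not_le.2 hn)

end LaguerreCellsCountable

/-! ### Mass balance and functions with almost countably many values. -/

section MeasureAux

lemma measure_eq_and_measure_diff_iUnion_eq_zero {α ι : Type*} [Countable ι] [MeasurableSpace α]
    {μ : Measure α} {Ω : Set α} (hΩ : μ Ω ≠ ∞) {m : ι → ℝ} (hm : ∀ i, 0 ≤ m i)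
    (hsum : HasSum m (μ Ω).toReal) {S : ι → Set α} (hSΩ : ∀ i, S i ⊆ Ω)
    (hS : ∀ i, NullMeasurableSet (S i) μ) (hd : Pairwise (Function.onFun (AEDisjoint μ) S))
    (hle : ∀ i, ENNReal.ofReal (m i) ≤ μ (S i)) :
    (∀ i, μ (S i) = ENNReal.ofReal (m i)) ∧ μ (Ω \ ⋃ i, S i) = 0 := by
  have hsum' : ∑' i, ENNReal.ofReal (m i) = μ Ω := by
    rw [← ENNReal.ofReal_tsum_of_nonneg hm hsum.summable, hsum.tsum_eq, ENNReal.ofReal_toReal hΩ]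
  have hU : μ (⋃ i, S i) = ∑' i, μ (S i) := measure_iUnion₀ hd hS
  have hUΩ : ⋃ i, S i ⊆ Ω := iUnion_subset hSΩ
  have hUeq : μ (⋃ i, S i) = μ Ω :=
    le_antisymm (measure_mono hUΩ) (by rw [hU, ← hsum']; exact ENNReal.tsum_le_tsum hle)
  refine ⟨fun i => ?_, ?_⟩
  · by_contra hne
    have := ENNReal.hasSum_lt hle (lt_of_le_of_ne (hle i) (Ne.symm hne)) (hsum' ▸ hΩ)
      ENNReal.summable.hasSum ENNReal.summable.hasSum
    rw [hsum', ← hU, hUeq] at this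
    exact this.false
  · rw [measure_sdiff hUΩ (.iUnion hS) (hUeq ▸ hΩ), hUeq, tsub_self]

/-- A Lipschitz map sends null sets to null sets, so the image of `[0, 1]` is null; yet it contains
the interval between `g 0` and `g 1`. -/
lemma LipschitzOnWith.eq_of_ae_mem_countable {g : ℝ → ℝ} {K : NNReal}
    (hg : LipschitzOnWith K g (Icc 0 1)) {C : Set ℝ} (hC : C.Countable)
    (h : ∀ᵐ t, t ∈ Icc (0 : ℝ) 1 → g t ∈ C) : g 0 = g 1 := by
  set S : Set ℝ := {t | t ∈ Icc (0 : ℝ) 1 ∧ g t ∉ C}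
  have hS : volume S = 0 := by
    refine measure_mono_null (fun t ht => ?_) (ae_iff.1 h)
    exact fun h' => ht.2 (h' ht.1)
  have hgS : volume (g '' S) = 0 := by
    have := (hg.mono fun t (ht : t ∈ S) => ht.1).hausdorffMeasure_image_le zero_le_one
    rw [hausdorffMeasure_real, hS] at this
    simpa using this
  have himg : volume (g '' Icc 0 1) = 0 := by
    refine measure_mono_null ?_ (measure_union_null hgS (hC.measure_zero volume))
    rintro _ ⟨t, ht, rfl⟩
    by_cases htC : g t ∈ C
    · exact Or.inr htC
    · exact Or.inl ⟨t, ⟨ht, htC⟩, rfl⟩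
  have hsub : uIcc (g 0) (g 1) ⊆ g '' Icc 0 1 := by
    have h1 := intermediate_value_uIcc (a := 0) (b := 1) (f := g)
      (by rw [uIcc_of_le zero_le_one]; exact hg.continuousOn)
    rwa [uIcc_of_le (zero_le_one (α := ℝ))] at h1
  have := measure_mono_null hsub himg
  rw [Real.volume_interval, ENNReal.ofReal_eq_zero] at this
  have := abs_nonpos_iff.1 this
  linarith

variable {E : Type*} [NormedAddCommGroup E] [NormedSpace ℝ E] [FiniteDimensional ℝ E]
  [MeasurableSpace E] [BorelSpace E] {μ : Measure E} [μ.IsAddHaarMeasure]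

/-- A locally Lipschitz function on a connected open set with almost all its values in a countable
set is constant. -/
theorem LocallyLipschitzOn.eq_of_ae_mem_countable {Ω : Set E} (hΩ : IsOpen Ω)
    (hΩc : IsPreconnected Ω) {h : E → ℝ} (hl : LocallyLipschitzOn Ω h) {C : Set ℝ}
    (hC : C.Countable) (hae : ∀ᵐ x ∂μ, x ∈ Ω → h x ∈ C) {x y : E} (hx : x ∈ Ω) (hy : y ∈ Ω) :
    h x = h y := by
  refine hΩc.induction₂ (fun x y => h x = h y) (fun z hz => ?_)
    (fun x y z _ _ _ => Eq.trans) (fun x y _ _ => Eq.symm) hx hy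
  obtain ⟨K, t, ht, hK⟩ := hl hz
  rw [hΩ.nhdsWithin_eq hz] at ht ⊢
  obtain ⟨r, hr, hball⟩ := Metric.mem_nhds_iff.1 (inter_mem ht (hΩ.mem_nhds hz))
  have hKb : LipschitzOnWith K h (Metric.ball z r) := hK.mono fun w hw => (hball hw).1
  filter_upwards [Metric.ball_mem_nhds z (half_pos hr)] with y hy
  set e : E := y - z
  have he : ‖e‖ < r / 2 := by simpa [e, dist_eq_norm] using hy
  have hin : ∀ w ∈ Metric.ball z (r / 2), ∀ t ∈ Icc (0 : ℝ) 1, w + t • e ∈ Metric.ball z r := by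
    intro w hw t ht
    rw [mem_ball_iff_norm] at hw ⊢
    calc ‖w + t • e - z‖ = ‖(w - z) + t • e‖ := by congr 1; abel
      _ ≤ ‖w - z‖ + ‖t • e‖ := norm_add_le _ _
      _ ≤ ‖w - z‖ + 1 * ‖e‖ := by
        rw [norm_smul, Real.norm_of_nonneg ht.1]
        gcongr
        exact ht.2
      _ < r := by linarith
  -- By Fubini, almost every line in direction `e` meets the exceptional set in a null set of
  -- parameters, so the one-dimensional case applies for almost every `w`. Density and continuity
  -- then reach `w = z`.
  have hshift : ∀ᵐ w ∂μ, ∀ᵐ t : ℝ, w + t • e ∈ Ω → h (w + t • e) ∈ C := by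
    obtain ⟨N, hNsub, hNm, hN⟩ := exists_measurable_superset_of_null (ae_iff.1 hae)
    have hswap : ∀ᵐ w ∂μ, ∀ᵐ t : ℝ, w + t • e ∉ N := by
      refine (Measure.ae_ae_comm (p := fun (w : E) (t : ℝ) => w + t • e ∉ N)
        (hNm.compl.preimage (by fun_prop : Measurable fun p : E × ℝ => p.1 + p.2 • e))).2
        (Eventually.of_forall fun t => ?_)
      have h0 : μ ((fun w => w + t • e) ⁻¹' N) = 0 := by rw [measure_preimage_add_right, hN]
      exact measure_eq_zero_iff_ae_notMem.1 h0
    filter_upwards [hswap] with w hw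
    filter_upwards [hw] with t ht
    by_contra hcon
    exact ht (hNsub hcon)
  have hgood : ∀ᵐ w ∂μ, w ∈ Metric.ball z (r / 2) → h w = h (w + e) := by
    filter_upwards [hshift] with w hw hwb
    have hL : LipschitzOnWith (K * ‖e‖₊) (fun t : ℝ => h (w + t • e)) (Icc 0 1) := by
      refine hKb.comp (LipschitzWith.lipschitzOnWith ?_) (fun t ht => hin w hwb t ht)
      refine LipschitzWith.of_dist_le_mul fun s t => ?_
      rw [dist_add_left, dist_eq_norm, ← sub_smul, norm_smul, mul_comm]
      rfl
    have := hL.eq_of_ae_mem_countable hC (by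
      filter_upwards [hw] with t ht htI
      exact ht (hball (hin w hwb t htI)).2)
    simpa using this
  have hzb : z ∈ Metric.ball z (r / 2) := Metric.mem_ball_self (half_pos hr)
  have hcl : z ∈ closure {w | w ∈ Metric.ball z (r / 2) → h w = h (w + e)} :=
    (Measure.dense_of_ae hgood) z
  have hcl2 : ∃ᶠ w in 𝓝 z, h w = h (w + e) :=
    ((mem_closure_iff_frequently.1 hcl).and_eventually
      (Metric.isOpen_ball.mem_nhds hzb)).mono fun w hw => hw.1 hw.2
  have hcont : ∀ w ∈ Metric.ball z r, ContinuousAt h w := fun w hw =>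
    hKb.continuousOn.continuousAt (Metric.isOpen_ball.mem_nhds hw)
  have hc1 : Tendsto h (𝓝 z) (𝓝 (h z)) := hcont z (Metric.mem_ball_self hr)
  have hc2 : Tendsto (fun w => h (w + e)) (𝓝 z) (𝓝 (h (z + e))) := by
    have h1 := hin z hzb 1 (by simp)
    rw [one_smul] at h1
    exact (hcont _ h1).tendsto.comp (by
      simpa using (tendsto_id (α := E) (x := 𝓝 z)).add_const e)
  have hze : z + e = y := by simp [e]
  rw [← hze]
  by_contra hne
  exact hcl2 ((hc1.prodMk_nhds hc2).eventually (isClosed_diagonal.isOpen_compl.mem_nhds hne))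

/-- A point of an open set is the midpoint of two points of any subset of full measure. -/
lemma exists_midpoint_mem_of_measure_diff_eq_zero {Ω G : Set E} (hΩ : IsOpen Ω)
    (hG : μ (Ω \ G) = 0) {x : E} (hx : x ∈ Ω) : ∃ y ∈ G, ∃ z ∈ G, y + z = (2 : ℝ) • x := by
  obtain ⟨r, hr, hball⟩ := Metric.isOpen_iff.1 hΩ x hx
  have hG' : μ ((fun y => (2 : ℝ) • x - y) ⁻¹' (Ω \ G)) = 0 :=
    (quasiMeasurePreserving_sub_left μ _).preimage_null hG
  obtain ⟨y, hy, hyN⟩ : ∃ y ∈ Metric.ball x r,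
      y ∉ (Ω \ G) ∪ (fun y => (2 : ℝ) • x - y) ⁻¹' (Ω \ G) := by
    by_contra! hcon
    exact (Metric.measure_ball_pos μ x hr).ne'
      (measure_mono_null hcon (measure_union_null hG hG'))
  have hy' : (2 : ℝ) • x - y ∈ Metric.ball x r := by
    rw [mem_ball_iff_norm'] at hy
    rw [mem_ball_iff_norm]
    convert hy using 2
    rw [two_smul]; abel
  rw [mem_union, not_or] at hyN
  refine ⟨y, ?_, (2 : ℝ) • x - y, ?_, by abel⟩
  · by_contra h
    exact hyN.1 ⟨hball hy, h⟩
  · by_contra h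
    exact hyN.2 ⟨hball hy', h⟩

end MeasureAux

/-! ### Overlaps of cells and finiteness of the supremum. -/

section LaguerreCellsMeasure

variable {E : Type*} [NormedAddCommGroup E] [InnerProductSpace ℝ E] [FiniteDimensional ℝ E]
  [MeasurableSpace E] [BorelSpace E] {μ : Measure E} [μ.IsAddHaarMeasure]
  {ι : Type*} {Ω : Set E} {v : ι → E} {a : ι → ℝ}

lemma addHaar_setOf_inner_eq {w : E} (hw : w ≠ 0) (c : ℝ) : μ {x | ⟪w, x⟫ = c} = 0 := by
  by_cases hne : ∃ x₀, ⟪w, x₀⟫ = c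
  · obtain ⟨x₀, rfl⟩ := hne
    have hker : μ (LinearMap.ker (innerₛₗ ℝ w) : Set E) = 0 := by
      refine Measure.addHaar_submodule μ _ fun htop => hw ?_
      have : w ∈ LinearMap.ker (innerₛₗ ℝ w) := htop ▸ Submodule.mem_top
      simpa using this
    have : {x | ⟪w, x⟫ = ⟪w, x₀⟫} = (fun x => x + -x₀) ⁻¹' (LinearMap.ker (innerₛₗ ℝ w) : Set E) := by
      ext x
      simp [inner_add_right, add_neg_eq_zero]
    rw [this, measure_preimage_add_right, hker]
  · push Not at hne
    simp [hne]

lemma aedisjoint_laguerreCell (hv : Function.Injective v) (Ω : Set E) (a : ι → ℝ) :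
    Pairwise (Function.onFun (AEDisjoint μ) (laguerreCell Ω v a)) := by
  intro i j hij
  refine measure_mono_null ?_
    (addHaar_setOf_inner_eq (μ := μ) (sub_ne_zero.2 (hv.ne hij)) (a i - a j))
  rintro x ⟨hi, hj⟩
  have h1 := hi.2 j
  have h2 := hj.2 i
  show ⟪v i - v j, x⟫ = a i - a j
  rw [inner_sub_left]
  linarith

/-- At a point of a cell the supremum is attained. Any other point of `Ω` is the midpoint of two
such points, and averaging their bounds suffices. -/
lemma bddAbove_affine_of_measure_diff_laguerreCell (hΩ : IsOpen Ω)
    (h : μ (Ω \ ⋃ i, laguerreCell Ω v a i) = 0) {x : E} (hx : x ∈ Ω) :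
    BddAbove (range fun i => ⟪v i, x⟫ - a i) := by
  obtain ⟨y, hy, z, hz, hyz⟩ := exists_midpoint_mem_of_measure_diff_eq_zero hΩ h hx
  obtain ⟨i, hi⟩ := mem_iUnion.1 hy
  obtain ⟨j, hj⟩ := mem_iUnion.1 hz
  refine ⟨((⟪v i, y⟫ - a i) + (⟪v j, z⟫ - a j)) / 2, ?_⟩
  rintro _ ⟨l, rfl⟩
  have h1 := hi.2 l
  have h2 := hj.2 l
  have h3 : ⟪v l, y⟫ + ⟪v l, z⟫ = 2 * ⟪v l, x⟫ := by
    rw [← inner_add_right, hyz, inner_smul_right]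
  simp only
  linarith

end LaguerreCellsMeasure

/-! ### Gradients of convex and affine functions. -/

section Gradient

variable {E : Type*} [NormedAddCommGroup E] [InnerProductSpace ℝ E] [CompleteSpace E]

lemma ConvexOn.add_inner_le_of_hasGradientAt {Ω : Set E} {ψ : E → ℝ} (hψ : ConvexOn ℝ Ω ψ)
    {p x y : E} (hx : x ∈ Ω) (hy : y ∈ Ω) (hp : HasGradientAt ψ p x) :
    ψ x + ⟪p, y - x⟫ ≤ ψ y := by
  have hconv := hψ.comp_affineMap (AffineMap.lineMap (k := ℝ) x y)
  have hder : HasDerivAt (ψ ∘ AffineMap.lineMap (k := ℝ) x y) ⟪p, y - x⟫ 0 := by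
    have h1 : HasFDerivAt ψ (InnerProductSpace.toDual ℝ E p) (AffineMap.lineMap (k := ℝ) x y 0) := by
      simpa using hp.hasFDerivAt
    simpa using h1.comp_hasDerivAt (0 : ℝ) AffineMap.hasDerivAt_lineMap
  have := hconv.le_slope_of_hasDerivAt (x := 0) (y := 1) (by simpa using hx) (by simpa using hy)
    one_pos hder
  simp only [slope_def_field, Function.comp_apply, AffineMap.lineMap_apply_one,
    AffineMap.lineMap_apply_zero, sub_zero, div_one] at this
  linarith

lemma hasGradientAt_inner_sub (w x : E) (c : ℝ) : HasGradientAt (fun y => ⟪w, y⟫ - c) w x := by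
  rw [hasGradientAt_iff_hasFDerivAt]
  exact (InnerProductSpace.toDual ℝ E w).hasFDerivAt.sub_const c

/-- An affine function that agrees with `⟪w, ·⟫ - c` near a point agrees with it everywhere. -/
lemma AffineMap.eq_inner_sub_of_eventuallyEq [FiniteDimensional ℝ E] (g : E →ᵃ[ℝ] ℝ) {w x : E}
    {c : ℝ} (h : ∀ᶠ y in 𝓝 x, g y = ⟪w, y⟫ - c) (y : E) : g y = ⟪w, y⟫ - c := by
  have h1 : HasFDerivAt g (LinearMap.toContinuousLinearMap g.linear) x := by
    rw [AffineMap.decomp g]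
    exact (LinearMap.toContinuousLinearMap g.linear).hasFDerivAt.add_const (g 0)
  have h2 : HasFDerivAt g (InnerProductSpace.toDual ℝ E w) x :=
    (hasGradientAt_inner_sub w x c).hasFDerivAt.congr_of_eventuallyEq h
  have h3 : g.linear (y - x) = ⟪w, y - x⟫ := by
    simpa using DFunLike.congr_fun (h1.unique h2) (y - x)
  have h4 := g.linearMap_vsub y x
  have h5 := h.self_of_nhds
  simp only [vsub_eq_sub] at h4
  rw [h3, inner_sub_right] at h4
  linarith

end Gradient

/-! ### Uniqueness, and identification of the affine set. -/

section Pieces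

variable {d : ℕ} {ι : Type*} {Ω : Set (EuclideanSpace ℝ (Fin d))}
  {v : ι → EuclideanSpace ℝ (Fin d)} {m : ι → ℝ} {φ ψ : EuclideanSpace ℝ (Fin d) → ℝ}
  {A B : ι → Set (EuclideanSpace ℝ (Fin d))}

lemma HasPieces.pairwise_disjoint (h : HasPieces Ω v m φ A) (hv : Function.Injective v) :
    Pairwise (Function.onFun Disjoint A) := fun i j hij => by
  refine disjoint_left.2 fun x hi hj => hij (hv ?_)
  exact (h.gradient_eq i x hi).unique (h.gradient_eq j x hj)

lemma HasPieces.nonempty (h : HasPieces Ω v m φ A) (hm : ∀ i, 0 < m i) (i : ι) :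
    (A i).Nonempty := by
  refine nonempty_of_measure_ne_zero (μ := volume) ?_
  rw [h.measure_eq]
  simpa using hm i

lemma HasPieces.measure_diff_eq_zero [Countable ι] (h : HasPieces Ω v m φ A)
    (hv : Function.Injective v) (hm : ∀ i, 0 < m i) (hΩ : IsBounded Ω)
    (hsum : HasSum m (volume Ω).toReal) : volume (Ω \ ⋃ i, A i) = 0 :=
  (measure_eq_and_measure_diff_iUnion_eq_zero hΩ.measure_lt_top.ne (fun i => (hm i).le) hsum
    h.subset (fun i => (h.isOpen i).measurableSet.nullMeasurableSet)
    (fun _ _ hij => (h.pairwise_disjoint hv hij).aedisjoint)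
    (fun i => (h.measure_eq i).ge)).2

/-- By convexity each tangent function is a minorant on all of `Ω`; two points of the same piece
give inequalities in both directions. -/
lemma HasPieces.exists_affine (h : HasPieces Ω v m φ A) (hφ : ConvexOn ℝ Ω φ)
    (hm : ∀ i, 0 < m i) :
    ∃ a : ι → ℝ, ∀ i, (∀ x ∈ A i, φ x = ⟪v i, x⟫ - a i) ∧ ∀ x ∈ Ω, ⟪v i, x⟫ - a i ≤ φ x := by
  choose p hp using h.nonempty hm
  have hle : ∀ i, ∀ x ∈ A i, ∀ y ∈ Ω, φ x + (⟪v i, y⟫ - ⟪v i, x⟫) ≤ φ y := fun i x hx y hy => by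
    rw [← inner_sub_right]
    exact hφ.add_inner_le_of_hasGradientAt (h.subset i hx) hy (h.gradient_eq i x hx)
  refine ⟨fun i => ⟪v i, p i⟫ - φ (p i), fun i => ⟨fun x hx => ?_, fun x hx => ?_⟩⟩
  · have h1 := hle i x hx (p i) (h.subset i (hp i))
    have h2 := hle i (p i) (hp i) x (h.subset i hx)
    linarith
  · have h2 := hle i (p i) (hp i) x hx
    linarith

/-- Comparison of superlevel sets of `ψ - φ`. -/
lemma HasPieces.offset_le [Countable ι] (hA : HasPieces Ω v m φ A) (hB : HasPieces Ω v m ψ B)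
    (hv : Function.Injective v) (hm : ∀ i, 0 < m i) (hΩ : IsBounded Ω)
    (hsum : HasSum m (volume Ω).toReal) {a b : ι → ℝ}
    (ha : ∀ i, (∀ x ∈ A i, φ x = ⟪v i, x⟫ - a i) ∧ ∀ x ∈ Ω, ⟪v i, x⟫ - a i ≤ φ x)
    (hb : ∀ i, (∀ x ∈ B i, ψ x = ⟪v i, x⟫ - b i) ∧ ∀ x ∈ Ω, ⟪v i, x⟫ - b i ≤ ψ x)
    {i j : ι} (hij : (A i ∩ B j).Nonempty) : a j - b j ≤ a i - b i := by
  by_contra! hlt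
  set I : Set ι := {l | a i - b i < a l - b l}
  -- On `A l ∩ B k` one has `a l - b l ≤ ψ - φ ≤ a k - b k`, so `l ∈ I` forces `k ∈ I`. Both unions
  -- have the same measure, hence agree almost everywhere; but the nonempty open set `A i ∩ B j`
  -- lies in the second and misses the first.
  have hPle : (⋃ l ∈ I, A l) ≤ᵐ[volume] ⋃ l ∈ I, B l := by
    refine ae_le_set.2 (measure_mono_null ?_ (hB.measure_diff_eq_zero hv hm hΩ hsum))
    rintro x ⟨hxP, hxQ⟩
    obtain ⟨l, hl, hxl⟩ := mem_iUnion₂.1 hxP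
    refine ⟨hA.subset l hxl, fun hx => hxQ ?_⟩
    obtain ⟨k, hxk⟩ := mem_iUnion.1 hx
    refine mem_iUnion₂.2 ⟨k, ?_, hxk⟩
    have h1 := (ha l).1 x hxl
    have h2 := (hb l).2 x (hA.subset l hxl)
    have h3 := (hb k).1 x hxk
    have h4 := (ha k).2 x (hB.subset k hxk)
    have hl : a i - b i < a l - b l := hl
    show a i - b i < a k - b k
    linarith
  have hmeas : volume (⋃ l ∈ I, B l) = volume (⋃ l ∈ I, A l) := by
    rw [measure_biUnion I.to_countable (fun k _ l _ hkl => hA.pairwise_disjoint hv hkl)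
      (fun l _ => (hA.isOpen l).measurableSet),
      measure_biUnion I.to_countable (fun k _ l _ hkl => hB.pairwise_disjoint hv hkl)
      (fun l _ => (hB.isOpen l).measurableSet)]
    simp only [hA.measure_eq, hB.measure_eq]
  have heq := ae_eq_of_ae_subset_of_measure_ge hPle hmeas.le
    (MeasurableSet.biUnion I.to_countable fun l _ => (hA.isOpen l).measurableSet).nullMeasurableSet
    (measure_ne_top_of_subset (iUnion₂_subset fun l _ => hB.subset l) hΩ.measure_lt_top.ne)
  refine (((hA.isOpen i).inter (hB.isOpen j)).measure_pos volume hij).ne'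
    (measure_mono_null ?_ (ae_le_set.1 heq.symm.le))
  rintro x ⟨hxi, hxj⟩
  refine ⟨mem_iUnion₂.2 ⟨j, hlt, hxj⟩, fun hx => ?_⟩
  obtain ⟨l, hl, hxl⟩ := mem_iUnion₂.1 hx
  have hil : i = l := by
    by_contra hne
    exact disjoint_left.1 (hA.pairwise_disjoint hv hne) hxi hxl
  subst hil
  exact lt_irrefl (a i - b i) hl

theorem HasPieces.exists_eq_add_const [Countable ι] (hΩb : IsBounded Ω) (hΩo : IsOpen Ω)
    (hv : Function.Injective v) (hm : ∀ i, 0 < m i) (hsum : HasSum m (volume Ω).toReal)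
    (hφ : ConvexOn ℝ Ω φ) (hψ : ConvexOn ℝ Ω ψ)
    (hA : HasPieces Ω v m φ A) (hB : HasPieces Ω v m ψ B) :
    ∃ c : ℝ, ∀ x ∈ Ω, ψ x = φ x + c := by
  obtain ⟨a, ha⟩ := hA.exists_affine hφ hm
  obtain ⟨b, hb⟩ := hB.exists_affine hψ hm
  obtain rfl | ⟨x₀, hx₀⟩ := Ω.eq_empty_or_nonempty
  · exact ⟨0, by simp⟩
  have hae : ∀ᵐ x, x ∈ Ω → (ψ - φ) x ∈ range fun i => a i - b i := by
    have hA0 := measure_eq_zero_iff_ae_notMem.1 (hA.measure_diff_eq_zero hv hm hΩb hsum)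
    have hB0 := measure_eq_zero_iff_ae_notMem.1 (hB.measure_diff_eq_zero hv hm hΩb hsum)
    filter_upwards [hA0, hB0] with x hxA hxB hx
    obtain ⟨i, hi⟩ := mem_iUnion.1 (by_contra fun h => hxA ⟨hx, h⟩)
    obtain ⟨j, hj⟩ := mem_iUnion.1 (by_contra fun h => hxB ⟨hx, h⟩)
    have h1 := hA.offset_le hB hv hm hΩb hsum ha hb ⟨x, hi, hj⟩
    have h2 := (ha i).1 x hi
    have h3 := (hb j).1 x hj
    have h4 := (ha j).2 x hx
    have h5 := (hb i).2 x hx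
    refine ⟨i, ?_⟩
    simp only [Pi.sub_apply]
    linarith
  have hlip : LocallyLipschitzOn Ω (ψ - φ) :=
    (hψ.locallyLipschitzOn hΩo).sub (hφ.locallyLipschitzOn hΩo)
  refine ⟨(ψ - φ) x₀, fun x hx => ?_⟩
  have := hlip.eq_of_ae_mem_countable hΩo hφ.1.isPreconnected (countable_range _) hae hx hx₀
  rw [← this]
  simp

/-- An open set where `φ` is affine meets some open cell, as the uncovered part is null. The affine
function is then that of the cell, and it dominates all others on the whole open set, which
therefore lies in the cell. -/
lemma affineSet_eq_iUnion_interior_laguerreCell (hΩo : IsOpen Ω) {a : ι → ℝ}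
    (h0 : volume (Ω \ ⋃ i, interior (laguerreCell Ω v a i)) = 0)
    (hφ : ∀ x ∈ Ω, ∀ i, ⟪v i, x⟫ - a i ≤ φ x)
    (heq : ∀ i, ∀ x ∈ laguerreCell Ω v a i, φ x = ⟪v i, x⟫ - a i) :
    ⋃ i, interior (laguerreCell Ω v a i) = affineSet Ω φ := by
  refine Subset.antisymm (iUnion_subset fun i x hx => ?_) ?_
  · refine ⟨(interior_subset hx).1, (innerₛₗ ℝ (v i)).toAffineMap - AffineMap.const ℝ _ (a i), ?_⟩
    filter_upwards [isOpen_interior.mem_nhds hx] with y hy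
    simpa using heq i y (interior_subset hy)
  · rintro x ⟨hx, g, hg⟩
    obtain ⟨U, hU, hUo, hxU⟩ := eventually_nhds_iff.1 (hg.and (hΩo.mem_nhds hx))
    obtain ⟨y, hyU, hy⟩ : ∃ y ∈ U, y ∈ ⋃ i, interior (laguerreCell Ω v a i) := by
      by_contra! hcon
      have hsub : U ⊆ Ω \ ⋃ i, interior (laguerreCell Ω v a i) :=
        fun y hy => ⟨(hU y hy).2, hcon y hy⟩
      exact (hUo.measure_pos volume ⟨x, hxU⟩).ne' (measure_mono_null hsub h0)
    obtain ⟨i, hi⟩ := mem_iUnion.1 hy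
    have hgi := g.eq_inner_sub_of_eventuallyEq (w := v i) (x := y) (c := a i) (by
      filter_upwards [isOpen_interior.mem_nhds hi, hUo.mem_nhds hyU] with z hz hzU
      rw [← (hU z hzU).1, heq i z (interior_subset hz)])
    refine mem_iUnion.2 ⟨i, mem_interior.2 ⟨U, fun z hz => ⟨(hU z hz).2, fun j => ?_⟩, hUo, hxU⟩⟩
    rw [← hgi, ← (hU z hz).1]
    exact hφ z (hU z hz).2 j

end Pieces

theorem mainTheorem1 {d : ℕ} {ι : Type*} [Countable ι]
    (Ω : Set (EuclideanSpace ℝ (Fin d)))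
    (hΩb : Bornology.IsBounded Ω) (hΩc : Convex ℝ Ω) (hΩo : IsOpen Ω)
    (v : ι → EuclideanSpace ℝ (Fin d)) (hv : Function.Injective v)
    (m : ι → ℝ) (hm : ∀ i, 0 < m i) (hsum : HasSum m (volume Ω).toReal) :
    ∃ (φ : EuclideanSpace ℝ (Fin d) → ℝ) (A : ι → Set (EuclideanSpace ℝ (Fin d))),
      ConvexOn ℝ Ω φ ∧ LocallyAffineAE Ω φ ∧ HasPieces Ω v m φ A ∧
      -- the sets `A i` are exactly the connected components of the set where `φ` is locally affine
      (⋃ i, A i) = affineSet Ω φ ∧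
      (∀ i, ∀ x ∈ A i, connectedComponentIn (affineSet Ω φ) x = A i) ∧
      -- uniqueness of `φ` on `Ω`, up to an additive constant
      ∀ (ψ : EuclideanSpace ℝ (Fin d) → ℝ) (B : ι → Set (EuclideanSpace ℝ (Fin d))),
        ConvexOn ℝ Ω ψ → LocallyAffineAE Ω ψ → HasPieces Ω v m ψ B →
        ∃ c : ℝ, ∀ x ∈ Ω, ψ x = φ x + c := by
  have hfin : volume Ω ≠ ∞ := hΩb.measure_lt_top.ne
  obtain ⟨a, ha⟩ : ∃ a : ι → ℝ, ∀ i, ENNReal.ofReal (m i) ≤ volume (laguerreCell Ω v a i) := by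
    cases isEmpty_or_nonempty ι
    · exact ⟨isEmptyElim, isEmptyElim⟩
    · exact exists_le_measure_laguerreCell hΩb hΩo.measurableSet v (fun i => (hm i).le) hsum
  obtain ⟨hmeas, hcov⟩ := measure_eq_and_measure_diff_iUnion_eq_zero hfin (fun i => (hm i).le) hsum
    (fun i x hx => hx.1)
    (fun i => (measurableSet_laguerreCell hΩo.measurableSet i).nullMeasurableSet)
    (aedisjoint_laguerreCell hv Ω a) ha
  -- Convex sets have null frontier, so passing to interiors loses no mass.
  have hint : ∀ i, interior (laguerreCell Ω v a i) =ᵐ[volume] laguerreCell Ω v a i := fun i =>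
    interior_ae_eq_of_null_frontier ((convex_laguerreCell hΩc i).addHaar_frontier volume)
  have hcov' : volume (Ω \ ⋃ i, interior (laguerreCell Ω v a i)) = 0 := by
    rw [measure_congr ((ae_eq_refl Ω).diff (Filter.EventuallyEq.countable_iUnion hint)), hcov]
  have hbdd := fun x (hx : x ∈ Ω) => bddAbove_affine_of_measure_diff_laguerreCell hΩo hcov hx
  set φ : EuclideanSpace ℝ (Fin d) → ℝ := fun x => ⨆ i, (⟪v i, x⟫ - a i)
  have hle : ∀ x ∈ Ω, ∀ i, ⟪v i, x⟫ - a i ≤ φ x := fun x hx i => le_ciSup (hbdd x hx) i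
  have heq : ∀ i, ∀ x ∈ laguerreCell Ω v a i, φ x = ⟪v i, x⟫ - a i := fun i x hx => by
    have : Nonempty ι := ⟨i⟩
    exact le_antisymm (ciSup_le hx.2) (hle x hx.1 i)
  have hφ : ConvexOn ℝ Ω φ := by
    cases isEmpty_or_nonempty ι
    · have : φ = fun _ => 0 := by
        ext x
        exact Real.iSup_of_isEmpty _
      rw [this]
      exact convexOn_const 0 hΩc
    · exact convexOn_iSup_affine hΩc hbdd
  have hpieces : HasPieces Ω v m φ fun i => interior (laguerreCell Ω v a i) :=
    { subset := fun i x hx => (interior_subset hx).1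
      isOpen := fun i => isOpen_interior
      convex := fun i => (convex_laguerreCell hΩc i).interior
      measure_eq := fun i => (measure_congr (hint i)).trans (hmeas i)
      gradient_eq := fun i x hx => by
        refine (hasGradientAt_inner_sub (v i) x (a i)).congr_of_eventuallyEq ?_
        filter_upwards [isOpen_interior.mem_nhds hx] with y hy
        exact heq i y (interior_subset hy) }
  have haff := affineSet_eq_iUnion_interior_laguerreCell hΩo hcov' hle heq
  refine ⟨φ, fun i => interior (laguerreCell Ω v a i), hφ, ?_, hpieces, haff, fun i x hx => ?_,
    fun ψ B hψ _ hB => hpieces.exists_eq_add_const hΩb hΩo hv hm hsum hφ hψ hB⟩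
  · rw [haff] at hcov'
    filter_upwards [measure_eq_zero_iff_ae_notMem.1 hcov'] with x hx hxΩ
    exact (by_contra fun h => hx ⟨hxΩ, h⟩ : x ∈ affineSet Ω φ).2
  · have hsub : interior (laguerreCell Ω v a i) ⊆ affineSet Ω φ :=
      haff ▸ subset_iUnion (fun i => interior (laguerreCell Ω v a i)) i
    refine Subset.antisymm ?_
      ((hpieces.convex i).isPreconnected.subset_connectedComponentIn hx hsub)
    -- The piece and the union of all the other pieces are disjoint open sets covering `affineSet Ω
    -- φ`.
    refine IsPreconnected.subset_left_of_subset_union isOpen_interior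
      (isOpen_biUnion fun j (_ : j ≠ i) => hpieces.isOpen j) ?_ ?_
      ⟨x, mem_connectedComponentIn (hsub hx), hx⟩ isPreconnected_connectedComponentIn
    · exact disjoint_iUnion₂_right.2 fun j hj => hpieces.pairwise_disjoint hv (Ne.symm hj)
    · refine (connectedComponentIn_subset _ _).trans (haff ▸ iUnion_subset fun j => ?_)
      by_cases hj : j = i
      · subst hj
        exact subset_union_left
      · exact subset_union_of_subset_right
          (subset_biUnion_of_mem (u := fun j => interior (laguerreCell Ω v a j)) hj) _
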